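/- Let $m,n\ge 0$, $\eta=\mathrm{diag}(-1,\dots,-1,1,\dots,1)$ ($m$ minus signs, $n$ plus signs), and let $M$ be a connected smooth manifold of dimension $m+n$ with a tetrad $\theta$, i.e. a smooth $\mathbb R^{m,n}$-valued one-form $\theta=(\theta^i)$ on $M$ that is a linear bijection $T_xM\to\mathbb R^{m,n}$ at each $x\in M$; let $\theta_i$ be the dual frame, $\theta^i(\theta_j)=\delta^i_j$. The tetrad defines the metric $g_{ab}=\eta_{ij}\theta^i_a\theta^j_b$ and the Weizenböck connection with coefficients $\Gamma^a{}_{bc}=\theta_i^a\partial_c\theta^i_b$ (where $c$ is the index of differentiation). The corresponding Cartan geometry $(\pi:P\to M,A)$ modeled on the orthogonal Klein geometry with $H=\mathrm O(m,n)$ is given by the orthonormal frame bundle $$P=\mathrm O(M,g)=\{(x,f): f:\mathbb R^{m,n}\to T_xM \text{ a linear isometry}\}\subset \mathrm{GL}(M)$$ and the Cartan connection $A=\omega+e$ on $P$, which in the coordinates $(x^a,f_i^a)$ of $\mathrm{GL}(M)$ induced by coordinates $(x^a)$ of $M$ reads $$e^i=(f^{-1})^i_a\,dx^a,\qquad \omega^i{}_j=(f^{-1})^i_a\,df^a_j+(f^{-1})^i_a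 f^b_j\,\Gamma^a{}_{bc}\,dx^c .$$ Let $\xi$ be a smooth vector field on $M$ and let $\bar\xi=\xi^a\frac{\partial}{\partial x^a}+f_i^b\,\partial_b\xi^a\frac{\partial}{\partial f_i^a}$ be its complete lift to $\mathrm{GL}(M)$. The Cartan geometry $(P,A)$ is called invariant under $\xi$ if $\bar\xi$ is tangent to $P$ and $\mathcal L_{\bar\xi}A=0$ on $P$. Then $(P,A)$ is invariant under $\xi$ if and only if $\xi$ acts on $\theta$ as the generator of a global Lorentz transformation, i.e. if and only if there is a constant matrix $\lambda\in\mathfrak o(m,n)$ (that is, $\lambda^{T}\eta=-\eta\lambda$) such that $$(\mathcal L_\xi\theta)^i_a=\lambda^i{}_j\,\theta^j_a\quad\text{on all of } M .$$ -/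

import Mathlib

open scoped Manifold ContDiff Matrix

namespace Weitzenboeck

noncomputable section

/-! ### The orthogonal model -/

/-- The translation part `𝔷 = ℝ^{m,n}` of the model algebra `𝔤 = 𝔥 ⊕ 𝔷`, `𝔥 = 𝔬(m,n)`. -/
abbrev Z (m n : ℕ) : Type := Fin m ⊕ Fin n → ℝ

/-- The matrix `η = diag(-1, …, -1, 1, …, 1)`, with `m` minus signs and `n` plus signs. -/
def eta (m n : ℕ) : Matrix (Fin m ⊕ Fin n) (Fin m ⊕ Fin n) ℝ :=
  Matrix.diagonal (Sum.elim (fun _ => -1) (fun _ => 1))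

/-- The bilinear form `η(z, w) = η_{ij} z^i w^j` on `ℝ^{m,n}`. -/
def etaForm {m n : ℕ} (z w : Z m n) : ℝ := z ⬝ᵥ (eta m n *ᵥ w)

/-- The Lie algebra `𝔬(m,n)`, i.e. the matrices `λ` with `λᵀ η = - η λ`. -/
abbrev orthogonalAlgebra (m n : ℕ) :
    Submodule ℝ (Matrix (Fin m ⊕ Fin n) (Fin m ⊕ Fin n) ℝ) :=
  skewAdjointMatricesSubmodule (eta m n)

/-! ### Calculus in coordinates -/

/-- The Lie derivative `L_X α` of a (vector valued) one-form `α` along a vector field `X`,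
in coordinates: `(L_X α)_a = X^c ∂_c α_a + α_c ∂_a X^c`. -/
def lieDerivForm {V F : Type*} [NormedAddCommGroup V] [NormedSpace ℝ V]
    [NormedAddCommGroup F] [NormedSpace ℝ F]
    (X : V → V) (α : V → V →L[ℝ] F) (u : V) : V →L[ℝ] F :=
  fderiv ℝ α u (X u) + (α u) ∘L (fderiv ℝ X u)

/-- `w` is tangent to `S` at `u`: it is the velocity at time `0` of a curve through `u` that
stays in `S`. -/
def IsTangentTo {V : Type*} [NormedAddCommGroup V] [NormedSpace ℝ V]
    (S : Set V) (u w : V) : Prop :=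
  ∃ c : ℝ → V, c 0 = u ∧ (∀ᶠ t in nhds (0 : ℝ), c t ∈ S) ∧ HasDerivAt c w 0

/-! ### The frame bundle and complete lifts -/

section FrameBundle

variable {m n : ℕ} {E : Type*} [NormedAddCommGroup E] [NormedSpace ℝ E]
  {M : Type*} [TopologicalSpace M] [ChartedSpace E M]

/-- The general linear frame bundle `GL(M)`: pairs of a point `x` and a linear bijection
`f : ℝ^{m,n} → T_x M`. -/
abbrev FrameBundle (m n : ℕ) (E : Type*) [NormedAddCommGroup E] [NormedSpace ℝ E]
    (M : Type*) [TopologicalSpace M] [ChartedSpace E M] : Type _ :=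
  Σ x : M, Z m n ≃L[ℝ] TangentSpace 𝓘(ℝ, E) x

/-- The space of the induced coordinates `(x^a, f_i^a)` on `GL(M)`. -/
abbrev FrameCoord (m n : ℕ) (E : Type*) [NormedAddCommGroup E] [NormedSpace ℝ E] :
    Type _ := E × (Z m n →L[ℝ] E)

/-- The induced coordinates `(x^a, f_i^a)` of a frame, for a chart `e` of `M`. -/
def frameCoord (e : OpenPartialHomeomorph M E) (u : FrameBundle m n E M) : FrameCoord m n E :=
  (e u.1, (mfderiv 𝓘(ℝ, E) 𝓘(ℝ, E) e u.1 : _ →L[ℝ] E) ∘L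
    (u.2 : Z m n →L[ℝ] TangentSpace 𝓘(ℝ, E) u.1))

/-- The part of a subset `P ⊆ GL(M)` over the domain of the chart `e`, in induced coordinates. -/
def inCoord (e : OpenPartialHomeomorph M E) (P : Set (FrameBundle m n E M)) :
    Set (FrameCoord m n E) :=
  frameCoord e '' {u | u ∈ P ∧ u.1 ∈ e.source}

/-- The components `ξ^a` of a vector field in the chart `e`, as a function of the coordinates. -/
def vectorCoord (e : OpenPartialHomeomorph M E)
    (ξ : ∀ x : M, TangentSpace 𝓘(ℝ, E) x) (y : E) : E :=
  mfderiv 𝓘(ℝ, E) 𝓘(ℝ, E) e (e.symm y) (ξ (e.symm y))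

/-- The complete lift `ξ^a ∂_a + f_i^b ∂_b ξ^a ∂/∂f_i^a` of `ξ` to `GL(M)`,
in the coordinates induced by `e`. -/
def completeLift (e : OpenPartialHomeomorph M E)
    (ξ : ∀ x : M, TangentSpace 𝓘(ℝ, E) x) (u : FrameCoord m n E) : FrameCoord m n E :=
  (vectorCoord e ξ u.1, (fderiv ℝ (vectorCoord e ξ) u.1) ∘L u.2)

/-- Invariance of a Cartan geometry `(P, A)`, `P ⊆ GL(M)`, under the vector field `ξ` on `M`:
the complete lift of `ξ` is tangent to `P`, and the Lie derivative of `A` along it vanishes on `P`,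
i.e. on all vectors tangent to `P`. The one-form `A` is given through its
expressions in the coordinates induced by the charts of `M`. -/
def IsInvariant {F : Type*} [NormedAddCommGroup F] [NormedSpace ℝ F]
    (P : Set (FrameBundle m n E M))
    (A : OpenPartialHomeomorph M E → FrameCoord m n E → FrameCoord m n E →L[ℝ] F)
    (ξ : ∀ x : M, TangentSpace 𝓘(ℝ, E) x) : Prop :=
  ∀ e ∈ IsManifold.maximalAtlas 𝓘(ℝ, E) ∞ M, ∀ u ∈ inCoord e P,
    IsTangentTo (inCoord e P) u (completeLift e ξ u) ∧
    ∀ w, IsTangentTo (inCoord e P) u w → lieDerivForm (completeLift e ξ) (A e) u w = 0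

/-- The solder form `e^i = (f⁻¹)^i_a dx^a`, in induced coordinates. -/
def solderForm (u : FrameCoord m n E) : FrameCoord m n E →L[ℝ] Z m n :=
  u.2.inverse ∘L ContinuousLinearMap.fst ℝ E (Z m n →L[ℝ] E)

/-- The connection form `ω^i_j = (f⁻¹)^i_a df_j^a + (f⁻¹)^i_a f_j^b Γ^a_{bc} dx^c` of a linear
connection, in induced coordinates. Here `Γ y v` is the endomorphism with entries
`Γ^a_{bc}(y) v^c`. -/
def connectionForm (Γ : E → E →L[ℝ] E →L[ℝ] E) (u : FrameCoord m n E) :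
    FrameCoord m n E →L[ℝ] (Z m n →L[ℝ] Z m n) :=
  (ContinuousLinearMap.compL ℝ (Z m n) E (Z m n) u.2.inverse) ∘L
    (ContinuousLinearMap.snd ℝ E (Z m n →L[ℝ] E) +
      ((ContinuousLinearMap.compL ℝ (Z m n) E E).flip u.2) ∘L
        (Γ u.1) ∘L ContinuousLinearMap.fst ℝ E (Z m n →L[ℝ] E))

end FrameBundle

/-! ### Weitzenböck geometry -/

/-- A tetrad on `M`: a smooth global coframe `θ`, i.e. a smooth `ℝ^{m,n}`-valued one-form which is
a linear bijection `T_x M → ℝ^{m,n}` at every point `x`. Here `M` is a smooth manifold modelled on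
the real vector space `E`; a tetrad forces `dim E = m + n`. -/
structure Tetrad (m n : ℕ) (E : Type*) [NormedAddCommGroup E] [NormedSpace ℝ E]
    (M : Type*) [TopologicalSpace M] [ChartedSpace E M]
    [IsManifold 𝓘(ℝ, E) ∞ M] where
  /-- The value of the tetrad at a point. -/
  coframe : ∀ x : M, TangentSpace 𝓘(ℝ, E) x ≃L[ℝ] Z m n
  smooth : ContMDiff 𝓘(ℝ, E) (𝓘(ℝ, E).prod 𝓘(ℝ, E →L[ℝ] Z m n)) ∞
    (fun x => Bundle.TotalSpace.mk' (E →L[ℝ] Z m n)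
      (E := fun x : M => TangentSpace 𝓘(ℝ, E) x →L[ℝ] Bundle.Trivial M (Z m n) x) x
      (coframe x : TangentSpace 𝓘(ℝ, E) x →L[ℝ] Z m n))

namespace Tetrad

variable {m n : ℕ} {E : Type*} [NormedAddCommGroup E] [NormedSpace ℝ E]
  {M : Type*} [TopologicalSpace M] [ChartedSpace E M]
  [IsManifold 𝓘(ℝ, E) ∞ M] (θ : Tetrad m n E M)

/-- The components `θ^i_a` in the chart `e`, as a function of the coordinates. -/
def coord (e : OpenPartialHomeomorph M E) (y : E) : E →L[ℝ] Z m n :=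
  (θ.coframe (e.symm y) : TangentSpace 𝓘(ℝ, E) (e.symm y) →L[ℝ] Z m n) ∘L
    (mfderiv 𝓘(ℝ, E) 𝓘(ℝ, E) e.symm y : E →L[ℝ] _)

/-- The metric `g_{ab} = η_{ij} θ^i_a θ^j_b`. -/
def metric (x : M) (v w : TangentSpace 𝓘(ℝ, E) x) : ℝ :=
  etaForm (θ.coframe x v) (θ.coframe x w)

/-- The orthonormal frame bundle `P = O(M, g)` of the metric defined by the tetrad. -/
def frames : Set (FrameBundle m n E M) :=
  {u | ∀ z w : Z m n, θ.metric u.1 (u.2 z) (u.2 w) = etaForm z w}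

/-- The coefficients `Γ^a_{bc} = θ_i^a ∂_c θ^i_b` of the Weitzenböck connection in the chart `e`;
`Γ y v` is the endomorphism with entries `Γ^a_{bc}(y) v^c`. -/
def christoffel (e : OpenPartialHomeomorph M E) (y : E) : E →L[ℝ] E →L[ℝ] E :=
  (ContinuousLinearMap.compL ℝ E (Z m n) E (θ.coord e y).inverse) ∘L
    (fderiv ℝ (θ.coord e) y)

/-- The Cartan connection `A = ω + e` of the Weitzenböck geometry, in induced coordinates,
as the pair `(ω, e)`. The formulas make sense on all of `GL(M)`, with `ω` valued in all
endomorphisms of `ℝ^{m,n}`; on vectors tangent to `P = O(M, g)` the values of `ω` lie in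
`𝔥 = 𝔬(m,n)`, and the Cartan connection is this restriction. -/
def cartanConnection (e : OpenPartialHomeomorph M E) (u : FrameCoord m n E) :
    FrameCoord m n E →L[ℝ] (Z m n →L[ℝ] Z m n) × Z m n :=
  (connectionForm (θ.christoffel e) u).prod (solderForm u)

/-- `(L_ξ θ)^i_a = λ^i_j θ^j_a` on all of `M`, with a constant matrix `λ`, in every chart. -/
def LieDerivEq (ξ : ∀ x : M, TangentSpace 𝓘(ℝ, E) x)
    (lam : Matrix (Fin m ⊕ Fin n) (Fin m ⊕ Fin n) ℝ) : Prop :=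
  ∀ e ∈ IsManifold.maximalAtlas 𝓘(ℝ, E) ∞ M, ∀ y ∈ e.target, ∀ v : E,
    lieDerivForm (vectorCoord e ξ) (θ.coord e) y v = lam *ᵥ (θ.coord e y v)

end Tetrad

end

end Weitzenboeck

/-! In a chart write `X` for ξ, `T` for θ, and `L_X T = K T` with `K = (L_X T) T⁻¹`, a function with
values in the endomorphisms of ℝ^{m,n}. Along the complete lift, `T f` has velocity `K T f`, so the
lift is tangent to the η-orthonormal frames exactly when `K` is η-skew. For `w = (v, φ)`, the Lie
derivative of the solder form vanishes identically and that of ω is `(T f)⁻¹ (D_v K) (T f)`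
(`lieDerivForm_cartan`, `hasFDerivAt_lieDerivEnd`). Every `v` is the base part of a vector tangent
to P, so invariance says that `K` is skew with zero derivative in every chart
(`localInvariance_iff`). Jacobians cancel in `(L_X T) T⁻¹`, so the local `K` glue to one function on
M (`lieDerivEnd_transition`). It is locally constant, hence constant by connectedness; its value is
the matrix λ. -/

namespace Weitzenboeck

/-! ### Lie derivative of the Cartan connection in coordinates -/

section LocalCalculus

variable {E F : Type*} [NormedAddCommGroup E] [NormedSpace ℝ E]
  [NormedAddCommGroup F] [NormedSpace ℝ F]

theorem differentiableAt_inverse [CompleteSpace E] (g : E ≃L[ℝ] F) :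
    DifferentiableAt ℝ (ContinuousLinearMap.inverse : (E →L[ℝ] F) → _) (g : E →L[ℝ] F) :=
  (contDiffAt_map_inverse (n := 1) g).differentiableAt (by norm_num)

/-- Differentiate `f⁻¹ ∘ f = id`, which holds on a neighbourhood of `g` because invertible maps form
an open set. -/
theorem fderiv_inverse [CompleteSpace E] (g : E ≃L[ℝ] F) (b : E →L[ℝ] F) :
    fderiv ℝ (ContinuousLinearMap.inverse : (E →L[ℝ] F) → _) (g : E →L[ℝ] F) b =
      -((g.symm : F →L[ℝ] E) ∘L b ∘L (g.symm : F →L[ℝ] E)) := by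
  have h1 := (differentiableAt_inverse g).hasFDerivAt.clm_comp
    (hasFDerivAt_id (𝕜 := ℝ) (g : E →L[ℝ] F))
  have h2 : (fun f : E →L[ℝ] F => f.inverse ∘L id f) =ᶠ[nhds (g : E →L[ℝ] F)]
      fun _ => ContinuousLinearMap.id ℝ E := by
    filter_upwards [g.nhds] with f hf
    obtain ⟨f', rfl⟩ := hf
    ext v
    simp
  have h3 := DFunLike.congr_fun (h1.unique
    ((hasFDerivAt_const (ContinuousLinearMap.id ℝ E) (g : E →L[ℝ] F)).congr_of_eventuallyEq h2)) b
  ext v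
  have h4 := DFunLike.congr_fun h3 (g.symm v)
  simp at h4
  simpa using eq_neg_of_add_eq_zero_right h4

theorem _root_.DifferentiableAt.clm_const_apply {U V W : Type*}
    [NormedAddCommGroup U] [NormedSpace ℝ U] [NormedAddCommGroup V] [NormedSpace ℝ V]
    [NormedAddCommGroup W] [NormedSpace ℝ W] {f : U → V} {u : U}
    (hf : DifferentiableAt ℝ f u) (A : V →L[ℝ] W) : DifferentiableAt ℝ (fun u => A (f u)) u :=
  A.differentiableAt.comp u hf

theorem fderiv_apply_apply {V W : Type*} [NormedAddCommGroup V] [NormedSpace ℝ V]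
    [NormedAddCommGroup W] [NormedSpace ℝ W] {α : V → E →L[ℝ] W} {u : V}
    (h : DifferentiableAt ℝ α u) (a : V) (w : E) :
    fderiv ℝ α u a w = fderiv ℝ (fun u => α u w) u a := by
  have := (h.hasFDerivAt.clm_apply (hasFDerivAt_const w u)).fderiv
  rw [this]
  simp

/-- The Lie derivative of a form with values in `F`, differentiated in the direction `v`. -/
theorem fderiv_lieDerivForm {X : E → E} {T : E → E →L[ℝ] F} {y : E}
    (hX : ContDiffAt ℝ 2 X y) (hT : ContDiffAt ℝ 2 T y) (v w : E) :
    fderiv ℝ (lieDerivForm X T) y v w =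
      fderiv ℝ (fderiv ℝ T) y v (X y) w + fderiv ℝ T y (fderiv ℝ X y v) w +
      (fderiv ℝ T y v (fderiv ℝ X y w) + T y (fderiv ℝ (fderiv ℝ X) y v w)) := by
  have hdT : HasFDerivAt (fderiv ℝ T) _ y :=
    ((hT.fderiv_right (m := 1) (by norm_num)).differentiableAt (by norm_num)).hasFDerivAt
  have hdX : HasFDerivAt (fderiv ℝ X) _ y :=
    ((hX.fderiv_right (m := 1) (by norm_num)).differentiableAt (by norm_num)).hasFDerivAt
  have hT1 := (hT.differentiableAt (by norm_num)).hasFDerivAt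
  have hX1 := (hX.differentiableAt (by norm_num)).hasFDerivAt
  have := ((hdT.clm_apply hX1).add (hT1.clm_comp hdX)).fderiv
  have h2 : lieDerivForm X T =
    (fun y => fderiv ℝ T y (X y)) + (fun y => T y ∘L fderiv ℝ X y) := rfl
  rw [h2, this]
  simp
  abel

variable [CompleteSpace E] [CompleteSpace F]

/-- The Weitzenböck Cartan connection of the coframe `T`, in induced coordinates. -/
noncomputable def cartanForm (T : E → E →L[ℝ] F) (u : E × (F →L[ℝ] E)) :
    (E × (F →L[ℝ] E)) →L[ℝ] (F →L[ℝ] F) × F :=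
  ((ContinuousLinearMap.compL ℝ F E F u.2.inverse) ∘L
    (ContinuousLinearMap.snd ℝ E (F →L[ℝ] E) +
      ((ContinuousLinearMap.compL ℝ F E E).flip u.2) ∘L
        ((ContinuousLinearMap.compL ℝ E F E (T u.1).inverse) ∘L (fderiv ℝ T u.1)) ∘L
          ContinuousLinearMap.fst ℝ E (F →L[ℝ] E))).prod
    (u.2.inverse ∘L ContinuousLinearMap.fst ℝ E (F →L[ℝ] E))

theorem differentiableAt_cartan {T : E → E →L[ℝ] F} {y : E}
    (hT : ContDiffAt ℝ 2 T y) (g : E ≃L[ℝ] F) (hg : T y = g) (f : F ≃L[ℝ] E) :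
    DifferentiableAt ℝ (cartanForm T) (y, (f : F →L[ℝ] E)) := by
  have hdT : DifferentiableAt ℝ (fderiv ℝ T) y :=
    ((hT.fderiv_right (m := 1) (by norm_num)).differentiableAt (by norm_num))
  have hT1 := (hT.differentiableAt (by norm_num))
  have hTi : DifferentiableAt ℝ (fun y => (T y).inverse) y :=
    DifferentiableAt.comp y (g := ContinuousLinearMap.inverse) (hg ▸ differentiableAt_inverse g) hT1
  have hfst : DifferentiableAt ℝ (Prod.fst : E × (F →L[ℝ] E) → E) (y, (f : F →L[ℝ] E)) :=
    differentiableAt_fst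
  have hsnd : DifferentiableAt ℝ (Prod.snd : E × (F →L[ℝ] E) → F →L[ℝ] E) (y, (f : F →L[ℝ] E)) :=
    differentiableAt_snd
  have hinv : DifferentiableAt ℝ (fun u : E × (F →L[ℝ] E) => u.2.inverse)
      (y, (f : F →L[ℝ] E)) :=
    DifferentiableAt.comp (f := Prod.snd) (g := ContinuousLinearMap.inverse) _
      (differentiableAt_inverse f) hsnd
  have hΓ : DifferentiableAt ℝ (fun u : E × (F →L[ℝ] E) =>
      (ContinuousLinearMap.compL ℝ E F E (T u.1).inverse) ∘L (fderiv ℝ T u.1))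
      (y, (f : F →L[ℝ] E)) := by
    have hc : DifferentiableAt ℝ
        (fun y => ContinuousLinearMap.compL ℝ E F E (T y).inverse) y :=
      hTi.clm_const_apply (W := (E →L[ℝ] F) →L[ℝ] E →L[ℝ] E) (ContinuousLinearMap.compL ℝ E F E)
    exact DifferentiableAt.comp (f := Prod.fst) (y, (f : F →L[ℝ] E)) (hc.clm_comp hdT) hfst
  have h1 : DifferentiableAt ℝ (fun u : E × (F →L[ℝ] E) =>
      ContinuousLinearMap.compL ℝ F E F u.2.inverse ∘L (ContinuousLinearMap.snd ℝ E (F →L[ℝ] E) +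
        ((ContinuousLinearMap.compL ℝ F E E).flip u.2) ∘L
        ((ContinuousLinearMap.compL ℝ E F E (T u.1).inverse) ∘L (fderiv ℝ T u.1)) ∘L
          ContinuousLinearMap.fst ℝ E (F →L[ℝ] E))) (y, (f : F →L[ℝ] E)) := by
    refine DifferentiableAt.clm_comp
      (hinv.clm_const_apply (W := (F →L[ℝ] E) →L[ℝ] F →L[ℝ] F) (ContinuousLinearMap.compL ℝ F E F)) ?_
    refine (differentiableAt_const _).add ?_
    refine DifferentiableAt.clm_comp
      (hsnd.clm_const_apply (W := (E →L[ℝ] E) →L[ℝ] F →L[ℝ] E) (ContinuousLinearMap.compL ℝ F E E).flip) ?_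
    exact hΓ.clm_comp (differentiableAt_const _)
  have h2 : DifferentiableAt ℝ (fun u : E × (F →L[ℝ] E) =>
      u.2.inverse ∘L ContinuousLinearMap.fst ℝ E (F →L[ℝ] E))
      (y, (f : F →L[ℝ] E)) := hinv.clm_comp (differentiableAt_const _)
  -- Pairing two linear maps into one with values in the product is itself continuous linear.
  exact (h1.prodMk h2).clm_const_apply
    (V := ((E × (F →L[ℝ] E)) →L[ℝ] (F →L[ℝ] F)) × ((E × (F →L[ℝ] E)) →L[ℝ] F))
    (W := (E × (F →L[ℝ] E)) →L[ℝ] (F →L[ℝ] F) × F)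
    (ContinuousLinearMap.prodₗᵢ ℝ).toContinuousLinearEquiv.toContinuousLinearMap

/-- Only the base part `w.1` survives: the terms in `w.2` cancel because the complete lift is linear
in the frame. -/
theorem lieDerivForm_cartan {X : E → E} {T : E → E →L[ℝ] F} {y : E}
    (hX : ContDiffAt ℝ 2 X y) (hT : ContDiffAt ℝ 2 T y) (g : E ≃L[ℝ] F) (hg : T y = g)
    (f : F ≃L[ℝ] E) (w : E × (F →L[ℝ] E)) :
    lieDerivForm (fun u : E × (F →L[ℝ] E) => (X u.1, (fderiv ℝ X u.1) ∘L u.2))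
      (cartanForm T) (y, (f : F →L[ℝ] E)) w =
    ((f.symm : E →L[ℝ] F) ∘L (g.symm : F →L[ℝ] E) ∘L
      (fderiv ℝ (lieDerivForm X T) y w.1 -
        lieDerivForm X T y ∘L (g.symm : F →L[ℝ] E) ∘L fderiv ℝ T y w.1) ∘L
      (f : F →L[ℝ] E), 0) := by
  have hdT : HasFDerivAt (fderiv ℝ T) _ y :=
    ((hT.fderiv_right (m := 1) (by norm_num)).differentiableAt (by norm_num)).hasFDerivAt
  have hdX : HasFDerivAt (fderiv ℝ X) _ y :=
    ((hX.fderiv_right (m := 1) (by norm_num)).differentiableAt (by norm_num)).hasFDerivAt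
  have hT1 := (hT.differentiableAt (by norm_num)).hasFDerivAt
  have hX1 := (hX.differentiableAt (by norm_num)).hasFDerivAt
  -- Differentiating Γ along `X` gives `D²T(X, v)`, whereas differentiating `L_X T` along `v` gives
  -- `D²T(v, X)`.
  have hsymm : ∀ a b, fderiv ℝ (fderiv ℝ T) y a b = fderiv ℝ (fderiv ℝ T) y b a :=
    fun a b => hT.isSymmSndFDerivAt (by simp) a b
  have hfst : HasFDerivAt (𝕜 := ℝ) (Prod.fst : E × (F →L[ℝ] E) → E) _ (y, (f : F →L[ℝ] E)) :=
    hasFDerivAt_fst (𝕜 := ℝ) (E := E) (F := F →L[ℝ] E)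
  have hsnd : HasFDerivAt (𝕜 := ℝ) (Prod.snd : E × (F →L[ℝ] E) → F →L[ℝ] E)
      (ContinuousLinearMap.snd ℝ E (F →L[ℝ] E)) (y, (f : F →L[ℝ] E)) :=
    hasFDerivAt_snd (𝕜 := ℝ) (E := E) (F := F →L[ℝ] E)
  have hgi := (hg ▸ differentiableAt_inverse g :
    DifferentiableAt ℝ (ContinuousLinearMap.inverse : (E →L[ℝ] F) → _) (T y)).hasFDerivAt
  have hfi := (differentiableAt_inverse f).hasFDerivAt
  have hTi := hgi.comp y hT1
  have hinv := HasFDerivAt.comp (f := Prod.snd) (y, (f : F →L[ℝ] E)) hfi hsnd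
  have hdTw := HasFDerivAt.comp (f := Prod.fst) (y, (f : F →L[ℝ] E))
    ((hTi.clm_comp (hdT.clm_apply (hasFDerivAt_const w.1 y)))) hfst
  have hom := hinv.clm_comp ((hasFDerivAt_const w.2 (y, (f : F →L[ℝ] E))).add
    (hdTw.clm_comp hsnd))
  have hso := hinv.clm_apply (hasFDerivAt_const w.1 (y, (f : F →L[ℝ] E)))
  have hlift := (HasFDerivAt.comp (f := Prod.fst) (y, (f : F →L[ℝ] E)) hX1 hfst).prodMk
    ((HasFDerivAt.comp (f := Prod.fst) (y, (f : F →L[ℝ] E)) hdX hfst).clm_comp hsnd)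
  have key := (hom.prodMk hso).fderiv
  have key2 := hlift.fderiv
  simp only [lieDerivForm, add_apply]
  rw [fderiv_apply_apply (differentiableAt_cartan hT g hg f)]
  erw [key, key2]
  refine Prod.ext ?_ ?_
  · ext1 z
    simp [cartanForm, hg, fderiv_inverse g, fderiv_inverse f, fderiv_lieDerivForm hX hT, hsymm w.1 (X y)]
    abel
  · simp [cartanForm, fderiv_inverse f]

end LocalCalculus

/-! ### Tangent vectors to the orthonormal frame bundle -/

section LocalFrames

variable {E F : Type*} [NormedAddCommGroup E] [NormedSpace ℝ E]
  [NormedAddCommGroup F] [NormedSpace ℝ F]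

/-- The frames over `U` that are orthonormal for the pullback of the form `B` by the coframe `T`. -/
def localFrames (B : F →L[ℝ] F →L[ℝ] ℝ) (U : Set E) (T : E → E →L[ℝ] F) :
    Set (E × (F →L[ℝ] E)) :=
  {u | u.1 ∈ U ∧ (∃ f : F ≃L[ℝ] E, (f : F →L[ℝ] E) = u.2) ∧
    ∀ z w, B (T u.1 (u.2 z)) (T u.1 (u.2 w)) = B z w}

/-- `K` is skew-adjoint for the bilinear form `B`. -/
def IsSkewFor (B : F →L[ℝ] F →L[ℝ] ℝ) (K : F →L[ℝ] F) : Prop :=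
  ∀ z w, B (K z) w + B z (K w) = 0

/-- By skewness the left side has zero derivative in `t`, so it equals its value at `t = 0`. -/
theorem IsSkewFor.exp_smul [CompleteSpace F] {B : F →L[ℝ] F →L[ℝ] ℝ} {K : F →L[ℝ] F}
    (hK : IsSkewFor B K) (t : ℝ) (z w : F) :
    B (NormedSpace.exp (t • K) z) (NormedSpace.exp (t • K) w) = B z w := by
  have hd : ∀ (z : F) (s : ℝ), HasDerivAt (fun s : ℝ => NormedSpace.exp (s • K) z)
      (K (NormedSpace.exp (s • K) z)) s := fun z s => by
    simpa using (hasDerivAt_exp_smul_const' K s).clm_apply (hasDerivAt_const s z)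
  have h : ∀ s : ℝ, HasDerivAt
      (fun s : ℝ => B (NormedSpace.exp (s • K) z) (NormedSpace.exp (s • K) w)) 0 s := fun s => by
    have h1 : HasDerivAt (fun s : ℝ => B (NormedSpace.exp (s • K) z)) _ s :=
      B.hasFDerivAt.comp_hasDerivAt s (hd z s)
    have := h1.clm_apply (hd w s)
    rwa [hK] at this
  have := is_const_of_deriv_eq_zero (fun s => (h s).differentiableAt) (fun s => (h s).deriv) t 0
  simpa using this

/-- Differentiate the orthonormality condition along a curve of frames with the given velocity. -/
theorem IsTangentTo.localFrames_skew {B : F →L[ℝ] F →L[ℝ] ℝ} {U : Set E} {T : E → E →L[ℝ] F}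
    {y : E} {f : F →L[ℝ] E} {v : E} {φ : F →L[ℝ] E} (hT : DifferentiableAt ℝ T y)
    (h : IsTangentTo (localFrames B U T) (y, f) (v, φ)) (z w : F) :
    B (fderiv ℝ T y v (f z) + T y (φ z)) (T y (f w)) +
      B (T y (f z)) (fderiv ℝ T y v (f w) + T y (φ w)) = 0 := by
  obtain ⟨c, h0, hc, hd⟩ := h
  have h1 : HasDerivAt (fun t => (c t).1) v 0 := by
    simpa [Function.comp_def] using hasFDerivAt_fst.comp_hasDerivAt (0 : ℝ) hd
  have h2 : HasDerivAt (fun t => (c t).2) φ 0 := by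
    simpa [Function.comp_def] using hasFDerivAt_snd.comp_hasDerivAt (0 : ℝ) hd
  have hT' : HasFDerivAt T (fderiv ℝ T y) (c 0).1 := by rw [h0]; exact hT.hasFDerivAt
  have h3 : HasDerivAt (fun t => T (c t).1) (fderiv ℝ T y v) 0 := hT'.comp_hasDerivAt (0 : ℝ) h1
  have h4 : ∀ z, HasDerivAt (fun t => T (c t).1 ((c t).2 z))
      (fderiv ℝ T y v (f z) + T y (φ z)) 0 := fun z => by
    have := h3.clm_apply (h2.clm_apply (hasDerivAt_const (0 : ℝ) z))
    simpa [h0] using this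
  have h5 : HasDerivAt (fun t => B (T (c t).1 ((c t).2 z)))
      (B (fderiv ℝ T y v (f z) + T y (φ z))) 0 :=
    B.hasFDerivAt.comp_hasDerivAt (0 : ℝ) (h4 z)
  have h6 := h5.clm_apply (h4 w)
  have h7 : HasDerivAt (fun t => B (T (c t).1 ((c t).2 z)) (T (c t).1 ((c t).2 w))) 0 0 := by
    refine (hasDerivAt_const (0 : ℝ) (B z w)).congr_of_eventuallyEq ?_
    filter_upwards [hc] with t ht using ht.2.2 z w
  simpa [h0] using h6.unique h7

/-- Used twice: `K = 0` gives a tangent vector over any base direction `v`, and `K = (L_X T) T⁻¹`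
with `v = X y` gives the complete lift. -/
theorem isTangentTo_localFrames [CompleteSpace E] [CompleteSpace F] {B : F →L[ℝ] F →L[ℝ] ℝ}
    {U : Set E} (hU : IsOpen U) {T : E → E →L[ℝ] F} (hinv : ∀ y ∈ U, ∃ g : E ≃L[ℝ] F, T y = g)
    {y : E} {f : F →L[ℝ] E} (hf : (y, f) ∈ localFrames B U T) (hT : DifferentiableAt ℝ T y)
    (g : E ≃L[ℝ] F) (hg : T y = g) {K : F →L[ℝ] F} (hK : IsSkewFor B K) (v : E) :
    IsTangentTo (localFrames B U T) (y, f)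
      (v, (g.symm : F →L[ℝ] E) ∘L (K ∘L (g : E →L[ℝ] F) ∘L f - fderiv ℝ T y v ∘L f)) := by
  obtain ⟨hy, ⟨f', hf'⟩, hB⟩ := hf
  simp only at hf' hB hy
  subst hf'
  have hl : HasDerivAt (fun t : ℝ => y + t • v) v 0 := by
    simpa using ((hasDerivAt_id (0 : ℝ)).smul_const v).const_add y
  -- Seen through the coframe, this curve is `exp(tK) T(y) f`, which stays orthonormal.
  refine ⟨fun t => (y + t • v, (T (y + t • v)).inverse ∘L
    (NormedSpace.exp (t • K) ∘L ((g : E →L[ℝ] F) ∘L (f' : F →L[ℝ] E)))), ?_, ?_, ?_⟩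
  · simp only [zero_smul, add_zero, NormedSpace.exp_zero, hg, ContinuousLinearMap.inverse_equiv]
    refine Prod.ext rfl ?_
    ext z
    simp
  · have : ∀ᶠ t in nhds (0 : ℝ), y + t • v ∈ U :=
      hl.continuousAt.eventually_mem (by simpa using hU.mem_nhds hy)
    filter_upwards [this] with t ht
    obtain ⟨g', hg'⟩ := hinv _ ht
    refine ⟨ht, ?_, ?_⟩
    · let : NormedAlgebra ℚ (F →L[ℝ] F) := NormedAlgebra.restrictScalars ℚ ℝ _
      -- An exponential is a unit, so the fibre component remains a linear equivalence.
      obtain ⟨e, he⟩ := NormedSpace.isUnit_exp (t • K)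
      refine ⟨f'.trans (g.trans ((ContinuousLinearEquiv.unitsEquiv ℝ F e).trans g'.symm)), ?_⟩
      ext z
      simp [hg', ← he]
    · intro z w
      simp only [hg', ContinuousLinearMap.inverse_equiv, ContinuousLinearMap.comp_apply,
        ContinuousLinearEquiv.coe_coe, ContinuousLinearEquiv.apply_symm_apply]
      rw [hK.exp_smul]
      simpa [hg] using hB z w
  · refine hl.prodMk ?_
    have hT0 : HasFDerivAt T (fderiv ℝ T y) (y + (0 : ℝ) • v) := by simpa using hT.hasFDerivAt
    have hT' : HasDerivAt (fun t : ℝ => T (y + t • v)) (fderiv ℝ T y v) 0 :=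
      hT0.comp_hasDerivAt (0 : ℝ) hl
    have hi : HasFDerivAt (ContinuousLinearMap.inverse : (E →L[ℝ] F) → _)
        (fderiv ℝ ContinuousLinearMap.inverse (g : E →L[ℝ] F)) (T (y + (0 : ℝ) • v)) := by
      simpa [hg] using (differentiableAt_inverse g).hasFDerivAt
    have hTi : HasDerivAt (fun t : ℝ => (T (y + t • v)).inverse)
        (fderiv ℝ ContinuousLinearMap.inverse (g : E →L[ℝ] F) (fderiv ℝ T y v)) 0 :=
      HasFDerivAt.comp_hasDerivAt (l := ContinuousLinearMap.inverse)
        (f := fun t : ℝ => T (y + t • v)) (0 : ℝ) hi hT'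
    have hexp := hasDerivAt_exp_smul_const' K (0 : ℝ)
    have := hTi.clm_comp (hexp.clm_comp
      (hasDerivAt_const (0 : ℝ) ((g : E →L[ℝ] F) ∘L (f' : F →L[ℝ] E))))
    refine this.congr_deriv ?_
    ext z
    simp [fderiv_inverse g, hg]
    abel

end LocalFrames

/-! ### The invariance criterion in one chart -/

section LocalInvariance

variable {E F : Type*} [NormedAddCommGroup E] [NormedSpace ℝ E]
  [NormedAddCommGroup F] [NormedSpace ℝ F]

/-- The endomorphism `K` with `L_X T = K T`. -/
noncomputable def lieDerivEnd (X : E → E) (T : E → E →L[ℝ] F) (y : E) : F →L[ℝ] F :=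
  lieDerivForm X T y ∘L (T y).inverse

theorem differentiableAt_lieDerivForm {X : E → E} {T : E → E →L[ℝ] F} {y : E}
    (hX : ContDiffAt ℝ 2 X y) (hT : ContDiffAt ℝ 2 T y) :
    DifferentiableAt ℝ (lieDerivForm X T) y := by
  have hdT : DifferentiableAt ℝ (fderiv ℝ T) y :=
    (hT.fderiv_right (m := 1) (by norm_num)).differentiableAt (by norm_num)
  have hdX : DifferentiableAt ℝ (fderiv ℝ X) y :=
    (hX.fderiv_right (m := 1) (by norm_num)).differentiableAt (by norm_num)
  exact (hdT.clm_apply (hX.differentiableAt (by norm_num))).add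
    ((hT.differentiableAt (by norm_num)).clm_comp hdX)

variable [CompleteSpace E]

/-- Product rule for `(L_X T) T⁻¹`; the bracket is the one in `lieDerivForm_cartan`, which is
thereby a conjugate of the derivative of `K`. -/
theorem hasFDerivAt_lieDerivEnd {X : E → E} {T : E → E →L[ℝ] F} {y : E}
    (hX : ContDiffAt ℝ 2 X y) (hT : ContDiffAt ℝ 2 T y) (g : E ≃L[ℝ] F) (hg : T y = g) :
    ∃ D : E →L[ℝ] F →L[ℝ] F, HasFDerivAt (lieDerivEnd X T) D y ∧ ∀ v, D v =
      (fderiv ℝ (lieDerivForm X T) y v -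
        lieDerivForm X T y ∘L (g.symm : F →L[ℝ] E) ∘L fderiv ℝ T y v) ∘L
          (g.symm : F →L[ℝ] E) := by
  have hL := (differentiableAt_lieDerivForm hX hT).hasFDerivAt
  have hi : HasFDerivAt (ContinuousLinearMap.inverse : (E →L[ℝ] F) → _)
      (fderiv ℝ ContinuousLinearMap.inverse (g : E →L[ℝ] F)) (T y) := by
    simpa [hg] using (differentiableAt_inverse g).hasFDerivAt
  have hTi : HasFDerivAt (fun y => (T y).inverse) _ y :=
    hi.comp y (hT.differentiableAt (by norm_num)).hasFDerivAt
  refine ⟨_, hL.clm_comp hTi, fun v => ?_⟩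
  ext z
  simp [fderiv_inverse g, hg]
  abel

/-- In a chart, the orthonormal frames and the Cartan connection of a coframe `T` are invariant
under `X` if and only if the endomorphism `K` with `L_X T = K T` is skew-adjoint and has zero
derivative. -/
theorem localInvariance_iff [CompleteSpace F] {B : F →L[ℝ] F →L[ℝ] ℝ} {U : Set E}
    (hU : IsOpen U) {X : E → E} {T : E → E →L[ℝ] F}
    (hinv : ∀ y ∈ U, ∃ g : E ≃L[ℝ] F, T y = g)
    (hX : ∀ y ∈ U, ContDiffAt ℝ 2 X y) (hT : ∀ y ∈ U, ContDiffAt ℝ 2 T y) :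
    (∀ u ∈ localFrames B U T,
      IsTangentTo (localFrames B U T) u (X u.1, (fderiv ℝ X u.1) ∘L u.2) ∧
      ∀ w, IsTangentTo (localFrames B U T) u w →
        lieDerivForm (fun u : E × (F →L[ℝ] E) => (X u.1, (fderiv ℝ X u.1) ∘L u.2))
          (cartanForm T) u w = 0) ↔
    ∀ y ∈ U, IsSkewFor B (lieDerivEnd X T y) ∧ HasFDerivAt (lieDerivEnd X T) (0 : E →L[ℝ] F →L[ℝ] F) y := by
  constructor
  · intro h y hy
    obtain ⟨g, hg⟩ := hinv y hy
    have hT1 := (hT y hy).differentiableAt (by norm_num)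
    -- Testing on the frame dual to the tetrad suffices: there `T f = id`.
    have hmem : (y, (g.symm : F →L[ℝ] E)) ∈ localFrames B U T :=
      ⟨hy, ⟨g.symm, rfl⟩, fun z w => by simp [hg]⟩
    obtain ⟨h1, h2⟩ := h _ hmem
    refine ⟨fun z w => ?_, ?_⟩
    · simpa [hg, lieDerivEnd, lieDerivForm] using h1.localFrames_skew hT1 z w
    · obtain ⟨D, hD, hDv⟩ := hasFDerivAt_lieDerivEnd (hX y hy) (hT y hy) g hg
      convert hD
      symm
      ext v z
      have h3 := h2 _ (isTangentTo_localFrames hU hinv hmem hT1 g hg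
        (K := 0) (fun z w => by simp) v)
      rw [lieDerivForm_cartan (hX y hy) (hT y hy) g hg g.symm, Prod.ext_iff] at h3
      have h4 := DFunLike.congr_fun h3.1 z
      rw [hDv]
      simpa using h4
  · rintro h ⟨y, f⟩ hu
    obtain ⟨hy, ⟨f', hf'⟩, -⟩ := id hu
    simp only at hy hf'
    subst hf'
    obtain ⟨g, hg⟩ := hinv y hy
    have hT1 := (hT y hy).differentiableAt (by norm_num)
    obtain ⟨h1, h2⟩ := h y hy
    refine ⟨?_, fun w _ => ?_⟩
    · convert isTangentTo_localFrames hU hinv hu hT1 g hg h1 (X y) using 2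
      ext z
      simp [lieDerivEnd, lieDerivForm, hg]
    · obtain ⟨D, hD, hDv⟩ := hasFDerivAt_lieDerivEnd (hX y hy) (hT y hy) g hg
      have h3 : ∀ v, fderiv ℝ (lieDerivForm X T) y v -
          lieDerivForm X T y ∘L (g.symm : F →L[ℝ] E) ∘L fderiv ℝ T y v = 0 := fun v => by
        ext x
        have := DFunLike.congr_fun (hDv v) (g x)
        rw [hD.unique h2] at this
        simpa using this.symm
      rw [lieDerivForm_cartan (hX y hy) (hT y hy) g hg f', h3]
      simp

end LocalInvariance

/-! ### Naturality of the Lie derivative -/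

section Naturality

variable {E F : Type*} [NormedAddCommGroup E] [NormedSpace ℝ E]
  [NormedAddCommGroup F] [NormedSpace ℝ F]

/-- Naturality of the Lie derivative of a one-form under a change of coordinates. -/
theorem lieDerivForm_pullback {X X' : E → E} {T T' : E → E →L[ℝ] F} {φ : E → E} {y : E}
    (hX : DifferentiableAt ℝ X y) (hX' : DifferentiableAt ℝ X' (φ y))
    (hT' : DifferentiableAt ℝ T' (φ y)) (hφ : ContDiffAt ℝ 2 φ y)
    (hXφ : ∀ᶠ x in nhds y, X' (φ x) = fderiv ℝ φ x (X x))
    (hTφ : ∀ᶠ x in nhds y, T x = T' (φ x) ∘L fderiv ℝ φ x) :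
    lieDerivForm X T y = lieDerivForm X' T' (φ y) ∘L fderiv ℝ φ y := by
  have hφ1 : HasFDerivAt φ (fderiv ℝ φ y) y := (hφ.differentiableAt (by norm_num)).hasFDerivAt
  have hdφ : HasFDerivAt (fderiv ℝ φ) _ y :=
    ((hφ.fderiv_right (m := 1) (by norm_num)).differentiableAt (by norm_num)).hasFDerivAt
  have h1 := ((hT'.hasFDerivAt.comp y hφ1).clm_comp hdφ).congr_of_eventuallyEq hTφ
  have h2 := (hX'.hasFDerivAt.comp y hφ1).unique
    ((hdφ.clm_apply hX.hasFDerivAt).congr_of_eventuallyEq hXφ)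
  ext w
  have h3 := DFunLike.congr_fun h2 w
  -- `D²φ` enters through `DT` as `(X, w)` and through the relation between `X` and `X'` as `(w,
  -- X)`; symmetry matches the two.
  have hs : fderiv ℝ (fderiv ℝ φ) y w (X y) = fderiv ℝ (fderiv ℝ φ) y (X y) w :=
    hφ.isSymmSndFDerivAt (by simp) _ _
  simp only [ContinuousLinearMap.comp_apply, add_apply, ContinuousLinearMap.flip_apply, hs] at h3
  simp [lieDerivForm, h1.fderiv, hTφ.self_of_nhds, hXφ.self_of_nhds, h3]
  abel

end Naturality

theorem two_le_infty : (2 : WithTop ℕ∞) ≤ ∞ :=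
  WithTop.coe_le_coe.2 (le_top : (2 : ℕ∞) ≤ ⊤)

/-! ### Coordinate expressions and changes of chart -/

section Charts

variable {m n : ℕ} {E : Type*} [NormedAddCommGroup E] [NormedSpace ℝ E]
  {M : Type*} [TopologicalSpace M] [ChartedSpace E M]

theorem mdifferentiable_of_mem_maximalAtlas {e : OpenPartialHomeomorph M E}
    (he : e ∈ IsManifold.maximalAtlas 𝓘(ℝ, E) ∞ M) : e.MDifferentiable 𝓘(ℝ, E) 𝓘(ℝ, E) :=
  ⟨(contMDiffOn_of_mem_maximalAtlas he).mdifferentiableOn (by simp),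
    (contMDiffOn_symm_of_mem_maximalAtlas he).mdifferentiableOn (by simp)⟩

theorem fderiv_transition {e e' : OpenPartialHomeomorph M E}
    (he : e ∈ IsManifold.maximalAtlas 𝓘(ℝ, E) ∞ M)
    (he' : e' ∈ IsManifold.maximalAtlas 𝓘(ℝ, E) ∞ M)
    {y : E} (hy : y ∈ e.target) (hy' : e.symm y ∈ e'.source) :
    fderiv ℝ (e' ∘ e.symm) y =
    ((mfderiv 𝓘(ℝ, E) 𝓘(ℝ, E) e' (e.symm y) : E →L[ℝ] E) ∘L
      (mfderiv 𝓘(ℝ, E) 𝓘(ℝ, E) e.symm y : E →L[ℝ] E)) := by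
  rw [← mfderiv_eq_fderiv]
  exact mfderiv_comp y ((mdifferentiable_of_mem_maximalAtlas he').mdifferentiableAt hy')
    ((mdifferentiable_of_mem_maximalAtlas he).mdifferentiableAt_symm hy)

theorem contDiffAt_transition {e e' : OpenPartialHomeomorph M E}
    (he : e ∈ IsManifold.maximalAtlas 𝓘(ℝ, E) ∞ M)
    (he' : e' ∈ IsManifold.maximalAtlas 𝓘(ℝ, E) ∞ M)
    {y : E} (hy : y ∈ e.target) (hy' : e.symm y ∈ e'.source) :
    ContDiffAt ℝ ∞ (e' ∘ e.symm) y := by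
  rw [← contMDiffAt_iff_contDiffAt]
  exact (contMDiffAt_of_mem_maximalAtlas he' hy').comp y
    (contMDiffAt_symm_of_mem_maximalAtlas he hy)

theorem vectorCoord_transition {e e' : OpenPartialHomeomorph M E}
    (he : e ∈ IsManifold.maximalAtlas 𝓘(ℝ, E) ∞ M)
    (he' : e' ∈ IsManifold.maximalAtlas 𝓘(ℝ, E) ∞ M)
    {y : E} (hy : y ∈ e.target) (hy' : e.symm y ∈ e'.source)
    (ξ : ∀ x : M, TangentSpace 𝓘(ℝ, E) x) :
    vectorCoord e' ξ ((e' ∘ e.symm) y) = fderiv ℝ (e' ∘ e.symm) y (vectorCoord e ξ y) := by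
  have h := DFunLike.congr_fun ((mdifferentiable_of_mem_maximalAtlas he).symm_comp_deriv
    (e.map_target hy)) (ξ (e.symm y))
  rw [fderiv_transition he he' hy hy']
  rw [e.right_inv hy] at h
  let X : E := vectorCoord e ξ y
  change mfderiv 𝓘(ℝ, E) 𝓘(ℝ, E) e.symm y X = ξ (e.symm y) at h
  change mfderiv 𝓘(ℝ, E) 𝓘(ℝ, E) e' (e'.symm (e' (e.symm y))) (ξ (e'.symm (e' (e.symm y)))) =
    mfderiv 𝓘(ℝ, E) 𝓘(ℝ, E) e' (e.symm y)
      (mfderiv 𝓘(ℝ, E) 𝓘(ℝ, E) e.symm y X)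
  rw [h, e'.left_inv hy']

variable [IsManifold 𝓘(ℝ, E) ∞ M]

theorem contDiffOn_vectorCoord {e : OpenPartialHomeomorph M E}
    (he : e ∈ IsManifold.maximalAtlas 𝓘(ℝ, E) ∞ M) {ξ : ∀ x : M, TangentSpace 𝓘(ℝ, E) x}
    (hξ : ContMDiff 𝓘(ℝ, E) 𝓘(ℝ, E).tangent ∞
      (fun x => (⟨x, ξ x⟩ : TangentBundle 𝓘(ℝ, E) M))) :
    ContDiffOn ℝ ∞ (vectorCoord e ξ) e.target := by
  rw [← contMDiffOn_iff_contDiffOn]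
  have h1 := (contMDiffOn_of_mem_maximalAtlas he).contMDiffOn_tangentMapWithin (m := ∞) (by simp)
    e.open_source.uniqueMDiffOn
  have h2 := hξ.comp_contMDiffOn (contMDiffOn_symm_of_mem_maximalAtlas he)
  have h3 := (contMDiff_snd_tangentBundle_modelSpace E 𝓘(ℝ, E) (n := ∞)).comp_contMDiffOn
    (h1.comp h2 (fun y hy => e.map_target hy))
  refine h3.congr fun y hy => ?_
  simp only [vectorCoord, Function.comp, tangentMapWithin]
  rw [mfderivWithin_of_isOpen e.open_source (e.map_target hy)]

/-- As `E` is finite dimensional, smoothness can be tested on each constant `v`: pair the smooth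
section θ with the image of `v` under the derivative of the inverse chart. -/
theorem contDiffOn_coord [FiniteDimensional ℝ E] (θ : Tetrad m n E M)
    {e : OpenPartialHomeomorph M E}
    (he : e ∈ IsManifold.maximalAtlas 𝓘(ℝ, E) ∞ M) :
    ContDiffOn ℝ ∞ (θ.coord e) e.target := by
  rw [contDiffOn_clm_apply]
  intro v
  rw [← contMDiffOn_iff_contDiffOn]
  have hs := contMDiffOn_symm_of_mem_maximalAtlas he
  have h1 := hs.contMDiffOn_tangentMapWithin (m := ∞) (by simp) e.open_target.uniqueMDiffOn
  have h0 : ContMDiffOn 𝓘(ℝ, E) 𝓘(ℝ, E).tangent ∞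
      (fun y : E => (⟨y, v⟩ : TangentBundle 𝓘(ℝ, E) E)) e.target :=
    contMDiffOn_vectorSpace_iff_contDiffOn.2 contDiffOn_const
  have h2 := h1.comp h0 (fun y hy => hy)
  have h3 := θ.smooth.comp_contMDiffOn hs
  have h4 := ContMDiffOn.clm_bundle_apply (F₂ := Z m n) (E₂ := Bundle.Trivial M (Z m n))
    (b := e.symm) (ϕ := fun y => (θ.coframe (e.symm y) :
      TangentSpace 𝓘(ℝ, E) (e.symm y) →L[ℝ] Bundle.Trivial M (Z m n) (e.symm y)))
    (v := fun y => mfderivWithin 𝓘(ℝ, E) 𝓘(ℝ, E) e.symm e.target y v) h3 h2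
  intro y hy
  have h5 := (Bundle.contMDiffWithinAt_totalSpace.1 (h4 y hy)).2
  refine h5.congr (fun z hz => ?_) ?_
  · rw [mfderivWithin_of_isOpen e.open_target hz]
    rfl
  · rw [mfderivWithin_of_isOpen e.open_target hy]
    rfl

/-- The value of the coordinate expression of a tetrad, as a linear equivalence. -/
theorem exists_equiv_coord (θ : Tetrad m n E M) {e : OpenPartialHomeomorph M E}
    (he : e ∈ IsManifold.maximalAtlas 𝓘(ℝ, E) ∞ M) {y : E} (hy : y ∈ e.target) :
    ∃ g : E ≃L[ℝ] Z m n, θ.coord e y = g :=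
  ⟨((mdifferentiable_of_mem_maximalAtlas he).symm.mfderiv hy).trans (θ.coframe (e.symm y)), rfl⟩

theorem coord_mfderiv (θ : Tetrad m n E M) {e : OpenPartialHomeomorph M E}
    (he : e ∈ IsManifold.maximalAtlas 𝓘(ℝ, E) ∞ M) {x : M} (hx : x ∈ e.source)
    (v : TangentSpace 𝓘(ℝ, E) x) :
    θ.coord e (e x) (mfderiv 𝓘(ℝ, E) 𝓘(ℝ, E) e x v) = θ.coframe x v := by
  have h := DFunLike.congr_fun ((mdifferentiable_of_mem_maximalAtlas he).symm_comp_deriv hx) v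
  have h2 : ∀ x', x' = x → θ.coframe x' = θ.coframe x := by rintro _ rfl; rfl
  change θ.coframe (e.symm (e x)) (mfderiv 𝓘(ℝ, E) 𝓘(ℝ, E) e.symm (e x)
    (mfderiv 𝓘(ℝ, E) 𝓘(ℝ, E) e x v)) = _
  change mfderiv 𝓘(ℝ, E) 𝓘(ℝ, E) e.symm (e x) (mfderiv 𝓘(ℝ, E) 𝓘(ℝ, E) e x v) = v at h
  rw [e.left_inv hx]
  exact congrArg (θ.coframe x) h

section Transition

variable {e e' : OpenPartialHomeomorph M E} (he : e ∈ IsManifold.maximalAtlas 𝓘(ℝ, E) ∞ M)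
  (he' : e' ∈ IsManifold.maximalAtlas 𝓘(ℝ, E) ∞ M)
  {y : E} (hy : y ∈ e.target) (hy' : e.symm y ∈ e'.source)

include he he' hy hy'

theorem coord_transition (θ : Tetrad m n E M) :
    θ.coord e y = θ.coord e' ((e' ∘ e.symm) y) ∘L fderiv ℝ (e' ∘ e.symm) y := by
  rw [fderiv_transition he he' hy hy']
  ext1 v
  exact (coord_mfderiv θ he' hy' _).symm

/-- Both `L_X T` and `T` change by precomposition with the same Jacobian, which drops out of `(L_X
T) T⁻¹`. -/
theorem lieDerivEnd_transition [FiniteDimensional ℝ E] (θ : Tetrad m n E M)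
    {ξ : ∀ x : M, TangentSpace 𝓘(ℝ, E) x}
    (hξ : ContMDiff 𝓘(ℝ, E) 𝓘(ℝ, E).tangent ∞
      (fun x => (⟨x, ξ x⟩ : TangentBundle 𝓘(ℝ, E) M))) :
    lieDerivEnd (vectorCoord e ξ) (θ.coord e) y =
      lieDerivEnd (vectorCoord e' ξ) (θ.coord e') (e' (e.symm y)) := by
  have hy2 : (e' ∘ e.symm) y ∈ e'.target := e'.map_source hy'
  have hev : ∀ᶠ x in nhds y, x ∈ e.target ∧ e.symm x ∈ e'.source :=
    (e.open_target.eventually_mem hy).and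
      ((e.continuousAt_symm hy).eventually_mem (e'.open_source.mem_nhds hy'))
  have h := lieDerivForm_pullback (X := vectorCoord e ξ) (X' := vectorCoord e' ξ)
    (T := θ.coord e) (T' := θ.coord e') (φ := e' ∘ e.symm) (y := y)
    (((contDiffOn_vectorCoord he hξ).contDiffAt (e.open_target.mem_nhds hy)).differentiableAt
      (by simp))
    (((contDiffOn_vectorCoord he' hξ).contDiffAt (e'.open_target.mem_nhds hy2)).differentiableAt
      (by simp))
    (((contDiffOn_coord θ he').contDiffAt (e'.open_target.mem_nhds hy2)).differentiableAt
      (by simp))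
    ((contDiffAt_transition he he' hy hy').of_le two_le_infty)
    (hev.mono fun x hx => vectorCoord_transition he he' hx.1 hx.2 ξ)
    (hev.mono fun x hx => coord_transition he he' hx.1 hx.2 θ)
  obtain ⟨g, hg⟩ := exists_equiv_coord θ he hy
  obtain ⟨g', hg'⟩ := exists_equiv_coord θ he' hy2
  have hT := coord_transition he he' hy hy' θ
  ext1 z
  have h1 : g' (fderiv ℝ (e' ∘ e.symm) y (g.symm z)) = z := by
    have := DFunLike.congr_fun hT (g.symm z)
    rw [hg, hg'] at this
    simpa using this.symm
  have h2 : fderiv ℝ (e' ∘ e.symm) y (g.symm z) = g'.symm z := by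
    rw [← h1, g'.symm_apply_apply, h1]
  change _ = lieDerivEnd (vectorCoord e' ξ) (θ.coord e') ((e' ∘ e.symm) y) z
  simp only [lieDerivEnd, hg, hg', ContinuousLinearMap.inverse_equiv, h,
    ContinuousLinearMap.comp_apply, ContinuousLinearEquiv.coe_coe, h2]

end Transition

end Charts

/-! ### Skewness for η in matrix form -/

section Model

variable {m n : ℕ}

/-- The form `η` on `ℝ^{m,n}` as a continuous bilinear map. -/
noncomputable def etaBilin (m n : ℕ) : Z m n →L[ℝ] Z m n →L[ℝ] ℝ :=
  LinearMap.toContinuousBilinearMap (Matrix.toLinearMap₂' ℝ (eta m n))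

theorem etaBilin_apply (z w : Z m n) : etaBilin m n z w = etaForm z w :=
  Matrix.toLinearMap₂'_apply' _ _ _

theorem isSkewFor_etaBilin_iff (lam : Matrix (Fin m ⊕ Fin n) (Fin m ⊕ Fin n) ℝ)
    (K : Z m n →L[ℝ] Z m n) (hK : ∀ z, K z = lam *ᵥ z) :
    IsSkewFor (etaBilin m n) K ↔ lam ∈ orthogonalAlgebra m n := by
  rw [mem_skewAdjointMatricesSubmodule]
  have h1 : ∀ z w : Z m n, etaBilin m n (K z) w + etaBilin m n z (K w) =
      z ⬝ᵥ ((lamᵀ * eta m n + eta m n * lam) *ᵥ w) := fun z w => by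
    rw [etaBilin_apply, etaBilin_apply, hK, hK, etaForm, etaForm, Matrix.add_mulVec,
      dotProduct_add, ← Matrix.mulVec_mulVec, ← Matrix.mulVec_mulVec, Matrix.mulVec_transpose,
      dotProduct_comm (lam *ᵥ z), Matrix.dotProduct_mulVec (eta m n *ᵥ w), dotProduct_comm (_ ᵥ* lam)]
  have h2 : (eta m n).IsSkewAdjoint lam ↔ lamᵀ * eta m n + eta m n * lam = 0 := by
    rw [Matrix.IsSkewAdjoint, Matrix.IsAdjointPair, Matrix.mul_neg, ← add_eq_zero_iff_eq_neg]
  rw [h2]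
  constructor
  · intro h
    ext i j
    have := h (Pi.single i 1) (Pi.single j 1)
    rw [h1] at this
    simpa using this
  · intro h z w
    rw [h1, h]
    simp

end Model

/-! ### Both sides of the equivalence in terms of `K` -/

section Invariance

variable {m n : ℕ} {E : Type*} [NormedAddCommGroup E] [NormedSpace ℝ E]
  {M : Type*} [TopologicalSpace M] [ChartedSpace E M]
  [IsManifold 𝓘(ℝ, E) ∞ M]

theorem inCoord_frames (θ : Tetrad m n E M) {e : OpenPartialHomeomorph M E}
    (he : e ∈ IsManifold.maximalAtlas 𝓘(ℝ, E) ∞ M) :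
    inCoord e θ.frames = localFrames (etaBilin m n) e.target (θ.coord e) := by
  ext ⟨y, f⟩
  constructor
  · rintro ⟨⟨x, f'⟩, ⟨hP, hx⟩, h⟩
    simp only [frameCoord, Prod.mk.injEq] at h
    obtain ⟨rfl, rfl⟩ := h
    refine ⟨e.map_source hx,
      ⟨f'.trans ((mdifferentiable_of_mem_maximalAtlas he).mfderiv hx), rfl⟩, fun z w => ?_⟩
    rw [etaBilin_apply, etaBilin_apply]
    refine Eq.trans ?_ (hP z w)
    exact congrArg₂ etaForm (coord_mfderiv θ he hx _) (coord_mfderiv θ he hx _)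
  · rintro ⟨hy, ⟨f', hf'⟩, hB⟩
    simp only at hy hf' hB
    subst hf'
    have hx := e.map_target hy
    have hd := (mdifferentiable_of_mem_maximalAtlas he).comp_symm_deriv hy
    refine ⟨⟨e.symm y, f'.trans ((mdifferentiable_of_mem_maximalAtlas he).symm.mfderiv hy)⟩,
      ⟨fun z w => ?_, hx⟩, ?_⟩
    · have := hB z w
      rw [etaBilin_apply, etaBilin_apply] at this
      exact this
    · refine Prod.ext (e.right_inv hy) ?_
      ext1 z
      exact DFunLike.congr_fun hd (f' z)

theorem isInvariant_iff [FiniteDimensional ℝ E] (θ : Tetrad m n E M)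
    {ξ : ∀ x : M, TangentSpace 𝓘(ℝ, E) x}
    (hξ : ContMDiff 𝓘(ℝ, E) 𝓘(ℝ, E).tangent ∞
      (fun x => (⟨x, ξ x⟩ : TangentBundle 𝓘(ℝ, E) M))) :
    IsInvariant θ.frames θ.cartanConnection ξ ↔
      ∀ e ∈ IsManifold.maximalAtlas 𝓘(ℝ, E) ∞ M, ∀ y ∈ e.target,
        IsSkewFor (etaBilin m n) (lieDerivEnd (vectorCoord e ξ) (θ.coord e) y) ∧
        HasFDerivAt (lieDerivEnd (vectorCoord e ξ) (θ.coord e))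
          (0 : E →L[ℝ] Z m n →L[ℝ] Z m n) y := by
  have : CompleteSpace E := FiniteDimensional.complete ℝ E
  refine forall₂_congr fun e he => ?_
  rw [inCoord_frames θ he, ← localInvariance_iff e.open_target
    (fun y hy => exists_equiv_coord θ he hy)
    (fun y hy => ((contDiffOn_vectorCoord he hξ).contDiffAt
      (e.open_target.mem_nhds hy)).of_le two_le_infty)
    (fun y hy => ((contDiffOn_coord θ he).contDiffAt
      (e.open_target.mem_nhds hy)).of_le two_le_infty)]
  -- `cartanForm` at `T = θ.coord e` and the explicit lift unfold to `θ.cartanConnection e` and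
  -- `completeLift e ξ`.
  rfl

theorem lieDerivEq_iff (θ : Tetrad m n E M) (ξ : ∀ x : M, TangentSpace 𝓘(ℝ, E) x)
    (lam : Matrix (Fin m ⊕ Fin n) (Fin m ⊕ Fin n) ℝ) (K : Z m n →L[ℝ] Z m n)
    (hK : ∀ z, K z = lam *ᵥ z) :
    θ.LieDerivEq ξ lam ↔ ∀ e ∈ IsManifold.maximalAtlas 𝓘(ℝ, E) ∞ M, ∀ y ∈ e.target,
      lieDerivEnd (vectorCoord e ξ) (θ.coord e) y = K := by
  refine forall₂_congr fun e he => forall₂_congr fun y hy => ?_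
  obtain ⟨g, hg⟩ := exists_equiv_coord θ he hy
  simp only [lieDerivEnd, hg, ContinuousLinearMap.inverse_equiv]
  constructor
  · intro h
    ext1 z
    simpa [hK] using h (g.symm z)
  · intro h v
    rw [← hK, ← h]
    simp

end Invariance
end Weitzenboeck

/-! ### From local to global -/

open Weitzenboeck in
theorem mainTheorem4 {m n : ℕ} {E : Type*} [NormedAddCommGroup E] [NormedSpace ℝ E]
    [FiniteDimensional ℝ E] {M : Type*} [TopologicalSpace M] [ChartedSpace E M]
    [IsManifold 𝓘(ℝ, E) ∞ M] [ConnectedSpace M]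
    (θ : Weitzenboeck.Tetrad m n E M)
    (ξ : ∀ x : M, TangentSpace 𝓘(ℝ, E) x)
    (hξ : ContMDiff 𝓘(ℝ, E) 𝓘(ℝ, E).tangent ∞ (fun x => (⟨x, ξ x⟩ : TangentBundle 𝓘(ℝ, E) M))) :
    Weitzenboeck.IsInvariant θ.frames θ.cartanConnection ξ ↔
      ∃ lam ∈ Weitzenboeck.orthogonalAlgebra m n, θ.LieDerivEq ξ lam := by
  rw [isInvariant_iff θ hξ]
  constructor
  · intro h
    let K : M → Z m n →L[ℝ] Z m n := fun x =>
      lieDerivEnd (vectorCoord (chartAt E x) ξ) (θ.coord (chartAt E x)) (chartAt E x x)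
    have hK : ∀ e ∈ IsManifold.maximalAtlas 𝓘(ℝ, E) ∞ M, ∀ y ∈ e.target,
        lieDerivEnd (vectorCoord e ξ) (θ.coord e) y = K (e.symm y) := fun e he y hy =>
      lieDerivEnd_transition he (IsManifold.chart_mem_maximalAtlas _) hy
        (mem_chart_source E _) θ hξ
    have hloc : IsLocallyConstant K := by
      rw [IsLocallyConstant.iff_eventually_eq]
      intro x
      have he := IsManifold.chart_mem_maximalAtlas (I := 𝓘(ℝ, E)) (n := ∞) x
      obtain ⟨r, hr, hball⟩ := Metric.isOpen_iff.1 (chartAt E x).open_target (chartAt E x x)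
        (mem_chart_target E x)
      have hev : ∀ᶠ x' in nhds x, x' ∈ (chartAt E x).source ∧
          chartAt E x x' ∈ Metric.ball (chartAt E x x) r :=
        ((chartAt E x).open_source.eventually_mem (mem_chart_source E x)).and
          (((chartAt E x).continuousAt (mem_chart_source E x)).eventually_mem
            (Metric.ball_mem_nhds _ hr))
      filter_upwards [hev] with x' hx'
      have h1 := hK _ he _ (hball hx'.2)
      rw [(chartAt E x).left_inv hx'.1] at h1
      rw [← h1]
      -- A ball is used because the chart target need not be convex.
      refine (convex_ball (chartAt E x x) r).is_const_of_fderivWithin_eq_zero (𝕜 := ℝ)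
        (fun y hy => (h _ he y (hball hy)).2.differentiableAt.differentiableWithinAt)
        (fun y hy => ?_) hx'.2 (Metric.mem_ball_self hr)
      rw [fderivWithin_of_isOpen Metric.isOpen_ball hy, (h _ he y (hball hy)).2.fderiv]
    obtain ⟨x₀⟩ := (inferInstance : Nonempty M)
    have hlam : ∀ z, K x₀ z = LinearMap.toMatrix' (K x₀ : Z m n →ₗ[ℝ] Z m n) *ᵥ z := fun z => by
      rw [LinearMap.toMatrix'_mulVec]
      rfl
    refine ⟨_, (isSkewFor_etaBilin_iff _ (K x₀) hlam).1
      (h _ (IsManifold.chart_mem_maximalAtlas x₀) _ (mem_chart_target E x₀)).1,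
      (lieDerivEq_iff θ ξ _ (K x₀) hlam).2 fun e he y hy => ?_⟩
    rw [hK e he y hy]
    exact hloc.apply_eq_of_isPreconnected isPreconnected_univ trivial trivial
  · rintro ⟨lam, hlam, h⟩ e he y hy
    let K : Z m n →L[ℝ] Z m n := LinearMap.toContinuousLinearMap (Matrix.toLin' lam)
    have hK : ∀ z, K z = lam *ᵥ z := fun z => Matrix.toLin'_apply lam z
    have hE := (lieDerivEq_iff θ ξ lam K hK).1 h e he
    refine ⟨?_, ?_⟩
    · rw [hE y hy]
      exact (isSkewFor_etaBilin_iff lam K hK).2 hlam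
    · refine (hasFDerivAt_const K y).congr_of_eventuallyEq ?_
      filter_upwards [e.open_target.mem_nhds hy] with x hx using hE x hx
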